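/- Let $M$ be a model category, i.e. a category with all small limits and colimits and with classes of weak equivalences, cofibrations and fibrations satisfying Quillen's axioms (two-out-of-three, retracts, lifting, factorization), and let $A$ be an object of $M$. Let $A\downarrow M$ be the undercategory: its objects are the morphisms $A\to B$ of $M$, and its morphisms from $A\to B$ to $A\to C$ are the morphisms $f\colon B\to C$ of $M$ commuting with the maps from $A$. Then $A\downarrow M$ has all small limits and colimits, and it has a model structure in which a morphism $f\colon (A\to B)\to (A\to C)$ is a weak equivalence, cofibration or fibration if and only if $f\colon B\to C$ is a weak equivalence, cofibration or fibration, respectively, in $M$. (If the factorizations in $M$ can be chosen functorially, then so can those in $A\downarrow M$; thus the statement holds whether or not functoriality of factorizations is part of the definition of a model category.) Moreover: 1. if $M$ is proper, then so is $A\downarrow M$; 2. if $M$ is cofibrantly generated, then so is $A\downarrow M$; 3. if $M$ is cellular, then so is $A\downarrow M$. The terms are used as follows. - A model category is *proper* if weak equivalences are closed under pushout along cofibrations and under pullback along fibrations. - For a set $I$ of maps, a *relative $I$-cell complex* is a transfinite composition of pushouts of elements of $I$. A *presentation* of a relative $I$-cell complex $X\to Y$ is an expression of it as the composition of a transfinite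 sequence $X=X_0\to X_1\to\cdots$, continuous at limit ordinals, with chosen pushout squares exhibiting each $X_\beta\to X_{\beta+1}$ as a pushout of a coproduct of a family of elements of $I$ (the cells attached at stage $\beta$). A *subcomplex* is a presented relative $I$-cell complex $X\to Z$ of the same length, whose cells at each stage form a subset of the cells of $X\to Y$ at that stage, together with a map of sequences under $X$ that is compatible with the attaching maps and the characteristic maps of the cells; its *size* is the cardinality of its set of cells. - An object $W$ is *small relative to* a class $D$ of maps if there is a cardinal $\kappa$ such that for every regular cardinal $\lambda\ge\kappa$ and every $\lambda$-sequence $X_0\to X_1\to\cdots$ (continuous at limit ordinals) with all $X_\beta\to X_{\beta+1}$ in $D$, the map $\operatorname{colim}_{\beta<\lambda}\mathrm{Hom}(W,X_\beta)\to\mathrm{Hom}(W,\operatorname{colim}_{\beta<\lambda}X_\beta)$ is bijective. - A model category is *cofibrantly generated* by sets of maps $I$ and $J$ if the domains of the elements of $I$ (resp. $J$) are small relative to the relative $I$-cell (resp. $J$-cell) complexes, the fibrations are exactly the maps with the right lifting property with respect to $J$, and the trivial fibrations are exactly the maps with the right lifting property with respect to $I$. It is *cofibrantly generated* if such sets exist.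 - An object $W$ is *compact* (relative to $I$) if there is a cardinal $\gamma$ such that for every presented relative $I$-cell complex $X\to Y$ every map $W\to Y$ factors through a subcomplex of size at most $\gamma$. - A map $f\colon X\to Y$ is an *effective monomorphism* if it is the equalizer of the two inclusions $Y\rightrightarrows Y\amalg_X Y$. - A model category is *cellular* if it is cofibrantly generated by some sets $I$ and $J$ such that the domains and codomains of the elements of $I$ and $J$ are compact relative to $I$, the domains of the elements of $J$ are small relative to the relative $I$-cell complexes, and all cofibrations are effective monomorphisms. -/

import Mathlib

open CategoryTheory Limits HomotopicalAlgebra Opposite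

universe v u

namespace UnderModel

section Proper

variable (C : Type u) [Category.{v} C] [ModelCategory C]

/-- Weak equivalences are closed under pushout along cofibrations. -/
def IsLeftProper : Prop :=
  ∀ ⦃X Y Z P : C⦄ ⦃w : X ⟶ Y⦄ ⦃i : X ⟶ Z⦄ ⦃i' : Y ⟶ P⦄ ⦃w' : Z ⟶ P⦄,
    IsPushout w i i' w' → weakEquivalences C w → cofibrations C i → weakEquivalences C w'

/-- Weak equivalences are closed under pullback along fibrations. -/
def IsRightProper : Prop :=
  ∀ ⦃P X Y Z : C⦄ ⦃w' : P ⟶ Y⦄ ⦃p' : P ⟶ X⦄ ⦃p : Y ⟶ Z⦄ ⦃w : X ⟶ Z⦄,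
    IsPullback w' p' p w → weakEquivalences C w → fibrations C p → weakEquivalences C w'

/-- A model category is proper if it is both left and right proper. -/
def IsProper : Prop := IsLeftProper C ∧ IsRightProper C

/-- The factorizations of the two factorization axioms can be chosen functorially. -/
def HasFunctorialFactorizations : Prop :=
  (trivialCofibrations C).HasFunctorialFactorization (fibrations C) ∧
    (cofibrations C).HasFunctorialFactorization (trivialFibrations C)

end Proper

section Cells

variable {C : Type u} [Category.{v} C]

/-- The relative `I`-cell complexes: transfinite compositions of pushouts of elements of `I`. -/
def relativeCells (I : MorphismProperty C) : MorphismProperty C :=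
  MorphismProperty.transfiniteCompositions.{v} I.pushouts

/-- `W` is small relative to `D`: there is a cardinal `κ` such that for every regular
cardinal `μ ≥ κ` and every `μ`-sequence `F` (a functor which is continuous at limit ordinals)
whose successor maps belong to `D`, the functor `Hom(W, -)` preserves the colimit of `F`,
i.e. `colim_β Hom(W, F β) ⟶ Hom(W, colim_β F β)` is bijective. -/
def IsSmallRelativeTo (W : C) (D : MorphismProperty C) : Prop :=
  ∃ κ : Cardinal.{v}, ∀ μ : Cardinal.{v}, μ.IsRegular → κ ≤ μ →
    ∀ (F : μ.ord.ToType ⥤ C), F.IsWellOrderContinuous →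
      (∀ β : μ.ord.ToType, D (F.map (homOfLE (Order.le_succ β)))) →
      PreservesColimit F (coyoneda.obj (op W))

variable {K : Type v} [LinearOrder K] [OrderBot K] [SuccOrder K] [WellFoundedLT K]
  {I : MorphismProperty C} {X Y : C} {f : X ⟶ Y}

/-- A subcomplex of a presented relative `I`-cell complex `c` on `f : X ⟶ Y`: a presented
relative cell complex `X ⟶ Z` of the same length, all of whose cells are cells of `c`
attached at the same stage (`π_injective`), with a map of sequences to the one of `c` that is
compatible with the maps from `X`, the attaching maps and the characteristic maps of cells.

The family of cells allowed at stage `j` is the family of cells of `c` at stage `j`, so that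
the field `π` of `AttachCells` becomes the inclusion of the cells of the subcomplex. -/
structure Subcomplex (c : RelativeCellComplex.{v} (fun _ : K ↦ I.homFamily) f) where
  /-- the target of the subcomplex -/
  Z : C
  /-- the underlying morphism of the subcomplex -/
  hom : X ⟶ Z
  /-- the presentation of the subcomplex -/
  complex : RelativeCellComplex.{v}
    (fun (j : K) (e : (hj : ¬ IsMax j) ×' (c.attachCells j hj).ι) ↦
      I.homFamily ((c.attachCells j e.1).π e.2)) hom
  π_injective (j : K) (hj : ¬ IsMax j) : Function.Injective (complex.attachCells j hj).π
  /-- the map of sequences -/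
  φ : complex.F ⟶ c.F
  φ_bot : complex.isoBot.inv ≫ φ.app ⊥ = c.isoBot.inv
  attaching_map (j : K) (hj : ¬ IsMax j) (i : (complex.attachCells j hj).ι) :
    ((complex.attachCells j hj).cofan₁.inj i ≫ (complex.attachCells j hj).g₁) ≫ φ.app j =
      (c.attachCells j hj).cofan₁.inj ((complex.attachCells j hj).π i).2 ≫
        (c.attachCells j hj).g₁
  characteristic_map (j : K) (hj : ¬ IsMax j) (i : (complex.attachCells j hj).ι) :
    (complex.attachCells j hj).cell i ≫ φ.app (Order.succ j) =
      (c.attachCells j hj).cell ((complex.attachCells j hj).π i).2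
  /-- the inclusion of the subcomplex, i.e. the map induced by `φ` on colimits -/
  ι : Z ⟶ Y
  incl_ι (j : K) : complex.incl.app j ≫ ι = φ.app j ≫ c.incl.app j

/-- The size of a subcomplex is the cardinality of its set of cells. -/
def Subcomplex.size {c : RelativeCellComplex.{v} (fun _ : K ↦ I.homFamily) f}
    (s : Subcomplex c) : Cardinal.{v} :=
  Cardinal.mk s.complex.Cells

/-- `W` is compact relative to `I`: there is a cardinal `γ` such that for every relative
`I`-cell complex `X ⟶ Y` with a chosen presentation, every map `W ⟶ Y` factors
through a subcomplex of size at most `γ`. -/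
def IsCompactRelativeTo (W : C) (I : MorphismProperty C) : Prop :=
  ∃ γ : Cardinal.{v}, ∀ (K : Type v) [LinearOrder K] [OrderBot K] [SuccOrder K]
    [WellFoundedLT K] (X Y : C) (f : X ⟶ Y)
    (c : RelativeCellComplex.{v} (fun _ : K ↦ I.homFamily) f) (g : W ⟶ Y),
    ∃ s : Subcomplex c, s.size ≤ γ ∧ ∃ l : W ⟶ s.Z, l ≫ s.ι = g

/-- `f : X ⟶ Y` is an effective monomorphism: it is the equalizer of the
two inclusions `Y ⇉ Y ⨿_X Y`. -/
def IsEffectiveMono {X Y : C} (f : X ⟶ Y) : Prop :=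
  ∃ (P : C) (i₁ i₂ : Y ⟶ P) (h : IsPushout f f i₁ i₂), Nonempty (IsLimit (Fork.ofι f h.w))

end Cells

section CofibrantlyGenerated

variable {C : Type u} [Category.{v} C] [ModelCategory C]

/-- The model category `C` is cofibrantly generated by the sets of maps `I` and `J`. -/
structure IsCofibrantlyGeneratedBy (I J : MorphismProperty C) : Prop where
  isSmall_I : MorphismProperty.IsSmall.{v} I
  isSmall_J : MorphismProperty.IsSmall.{v} J
  small_dom_I : ∀ ⦃X Y : C⦄ (i : X ⟶ Y), I i → IsSmallRelativeTo X (relativeCells I)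
  small_dom_J : ∀ ⦃X Y : C⦄ (j : X ⟶ Y), J j → IsSmallRelativeTo X (relativeCells J)
  fibrations_eq : fibrations C = J.rlp
  trivialFibrations_eq : trivialFibrations C = I.rlp

/-- The model category `C` is cellular with respect to the sets of maps `I` and `J`. -/
structure IsCellularBy (I J : MorphismProperty C) : Prop
    extends IsCofibrantlyGeneratedBy I J where
  compact_I : ∀ ⦃X Y : C⦄ (i : X ⟶ Y), I i →
    IsCompactRelativeTo X I ∧ IsCompactRelativeTo Y I
  compact_J : ∀ ⦃X Y : C⦄ (j : X ⟶ Y), J j →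
    IsCompactRelativeTo X I ∧ IsCompactRelativeTo Y I
  small_dom_J_I : ∀ ⦃X Y : C⦄ (j : X ⟶ Y), J j → IsSmallRelativeTo X (relativeCells I)
  effectiveMono : ∀ ⦃X Y : C⦄ (f : X ⟶ Y), cofibrations C f → IsEffectiveMono f

variable (C)

/-- The model category `C` is cofibrantly generated. -/
def IsCofibrantlyGenerated : Prop :=
  ∃ I J : MorphismProperty C, IsCofibrantlyGeneratedBy I J

/-- The model category `C` is cellular. -/
def IsCellular : Prop :=
  ∃ I J : MorphismProperty C, IsCellularBy I J

end CofibrantlyGenerated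

end UnderModel

/-!
The three classes of maps of `Under A` are created by the forgetful functor `Under.forget A`, and
liftings, factorizations and effective monomorphisms are inherited from `M`. For the generation
statements, `Under.forget A` has the left adjoint `Under.costar A`, which sends `X` to
`A ⟶ A ⨿ X`, and the unit squares on `X ⟶ A ⨿ X` and `Y ⟶ A ⨿ Y` of a map `m : X ⟶ Y` are
pushouts. By pasting, a map under `A` is a pushout of the free map on `m` if and only if the
underlying map is a pushout of `m` along the transposed attaching map. Since `Under.forget A`
creates connected colimits, relative cell complexes on the free maps on `I` correspond, cell by
cell, to relative `I`-cell complexes starting at an object under `A`. Lifting properties,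
smallness and compactness then transfer along the adjunction.
-/

namespace UnderModel

universe w

section Adjunction

variable {C : Type*} [Category* C] {D : Type*} [Category* D] {F : C ⥤ D} {U : D ⥤ C}

lemma isPushout_map_iff_isPushout_homEquiv (adj : F ⊣ U) (hadj : NatTrans.Coequifibered adj.unit)
    [PreservesColimitsOfShape WalkingSpan U] [ReflectsColimitsOfShape WalkingSpan U]
    {X Y : C} {m : X ⟶ Y} {B B' : D} {f : B ⟶ B'} {g₁ : F.obj X ⟶ B} {g₂ : F.obj Y ⟶ B'} :
    IsPushout g₁ (F.map m) f g₂ ↔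
      IsPushout (adj.homEquiv X B g₁) m (U.map f) (adj.homEquiv Y B' g₂) := by
  simp only [Adjunction.homEquiv_unit]
  refine ⟨fun sq ↦ (hadj m).flip.paste_horiz (sq.map U), fun sq ↦ ?_⟩
  have w : g₁ ≫ f = F.map m ≫ g₂ := (adj.homEquiv _ _).injective <| by
    simpa [Adjunction.homEquiv_unit] using sq.w
  have w' : U.map g₁ ≫ U.map f = U.map (F.map m) ≫ U.map g₂ := by
    rw [← U.map_comp, w, U.map_comp]
  exact .of_map U w (((hadj m).flip.paste_horiz_iff w').1 sq)

lemma rlp_strictMap (adj : F ⊣ U) (I : MorphismProperty C) :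
    (I.strictMap F).rlp = I.rlp.inverseImage U := by
  ext B B' f
  refine ⟨fun hf X Y i hi ↦ (adj.hasLiftingProperty_iff i f).1 (hf _ ⟨hi⟩), ?_⟩
  rintro hf _ _ _ ⟨hi⟩
  exact (adj.hasLiftingProperty_iff _ f).2 (hf _ hi)

lemma strictMap_eq_ofHoms (F : C ⥤ D) (I : MorphismProperty C) :
    I.strictMap F = MorphismProperty.ofHoms fun i : I.toSet ↦ F.map (I.homFamily i) := by
  ext X Y f
  constructor
  · rintro ⟨hi⟩
    exact ⟨(⟨Arrow.mk _, hi⟩ : I.toSet)⟩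
  · rintro ⟨i⟩
    exact ⟨i.2⟩

instance isSmall_strictMap (I : MorphismProperty C) [MorphismProperty.IsSmall.{v} I] :
    MorphismProperty.IsSmall.{v} (I.strictMap F) := by
  rw [strictMap_eq_ofHoms]
  infer_instance

end Adjunction

lemma isPushout_coprod_inr {C : Type*} [Category* C] [HasBinaryCoproducts C] (A : C) {X Y : C}
    (m : X ⟶ Y) :
    IsPushout m (coprod.inr : X ⟶ A ⨿ X) (coprod.inr : Y ⟶ A ⨿ Y) (coprod.map (𝟙 A) m) :=
  (IsPushout.of_coprod_inl_with_id m A).flip.of_iso (Iso.refl _) (Iso.refl _)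
    (coprod.braiding X A) (coprod.braiding Y A) (by simp) (by simp [coprod.inl_desc])
      (by simp [coprod.inl_desc]) (by simp)

lemma coequifibered_unit_costarAdjForget {C : Type*} [Category* C] [HasBinaryCoproducts C]
    (A : C) : NatTrans.Coequifibered (Under.costarAdjForget A).unit := by
  intro X Y m
  have unit_app (Z : C) : (Under.costarAdjForget A).unit.app Z = coprod.inr := by
    simp only [Under.costarAdjForget, Adjunction.comp_unit_app, Monad.adj_unit, coprodMonad_η_app,
      Equivalence.toAdjunction_unit, Equivalence.unit, algebraEquivUnder_unitIso,
      NatIso.ofComponents_hom_app]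
    exact Category.comp_id _
  rw [unit_app, unit_app]
  exact isPushout_coprod_inr A m

noncomputable section AttachCells

variable {C : Type*} [Category* C] {D : Type*} [Category* D] {F : C ⥤ D} {U : D ⥤ C}

/-- The attaching map of a cell, the counterpart of `AttachCells.cell` for the sources of the
cells. -/
def attachingMap {α : Type*} {X Y : α → C} {g : ∀ a, X a ⟶ Y a} {B B' : C} {f : B ⟶ B'}
    (c : AttachCells.{w} g f) (i : c.ι) : X (c.π i) ⟶ B :=
  c.cofan₁.inj i ≫ c.g₁

section Sigma

variable {ι : Type*} (X : ι → C) [HasCoproduct X]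

/-- The comparison of the image under `F` of a coproduct which `F` preserves with an arbitrary
coproduct of the images. -/
def mapSigmaIso (F : C ⥤ D) [PreservesColimit (Discrete.functor X) F]
    {d : Cofan fun i ↦ F.obj (X i)} (hd : IsColimit d) : F.obj (∐ X) ≅ d.pt :=
  (isColimitCofanMkObjOfIsColimit F _ _ (coproductIsCoproduct X)).coconePointUniqueUpToIso hd

lemma map_ι_mapSigmaIso_hom (F : C ⥤ D) [PreservesColimit (Discrete.functor X) F]
    {d : Cofan fun i ↦ F.obj (X i)} (hd : IsColimit d) (i : ι) :
    F.map (Sigma.ι X i) ≫ (mapSigmaIso X F hd).hom = d.inj i :=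
  (isColimitCofanMkObjOfIsColimit F _ _
    (coproductIsCoproduct X)).comp_coconePointUniqueUpToIso_hom hd (Discrete.mk i)

lemma ι_homEquiv_mapSigmaIso_hom_comp (adj : F ⊣ U) [PreservesColimit (Discrete.functor X) F]
    {d : Cofan fun i ↦ F.obj (X i)} (hd : IsColimit d) {B : D} (y : d.pt ⟶ B) (i : ι) :
    Sigma.ι X i ≫ adj.homEquiv _ B ((mapSigmaIso X F hd).hom ≫ y) =
      adj.homEquiv _ B (d.inj i ≫ y) := by
  rw [← adj.homEquiv_naturality_left, ← Category.assoc, map_ι_mapSigmaIso_hom]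

lemma mapSigmaIso_hom_comp (F : C ⥤ D) {Y : ι → C} [HasCoproduct Y]
    [PreservesColimit (Discrete.functor X) F] [PreservesColimit (Discrete.functor Y) F]
    {d : Cofan fun i ↦ F.obj (X i)} (hd : IsColimit d)
    {d' : Cofan fun i ↦ F.obj (Y i)} (hd' : IsColimit d') (g : ∀ i, X i ⟶ Y i) (m : d.pt ⟶ d'.pt)
    (hm : ∀ i, d.inj i ≫ m = F.map (g i) ≫ d'.inj i) :
    (mapSigmaIso X F hd).hom ≫ m = F.map (Limits.Sigma.map g) ≫ (mapSigmaIso Y F hd').hom := by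
  refine Cofan.IsColimit.hom_ext (isColimitCofanMkObjOfIsColimit F _ _
    (coproductIsCoproduct X)) _ _ fun i ↦ ?_
  change F.map (Sigma.ι X i) ≫ _ = F.map (Sigma.ι X i) ≫ _
  rw [reassoc_of% map_ι_mapSigmaIso_hom X F hd i, hm, ← F.map_comp_assoc, Sigma.ι_map,
    F.map_comp_assoc, map_ι_mapSigmaIso_hom]

end Sigma

variable {α : Type*} {X Y : α → C} {g : ∀ a, X a ⟶ Y a} {B B' : D} {f : B ⟶ B'}
  [PreservesColimitsOfShape WalkingSpan U] [ReflectsColimitsOfShape WalkingSpan U]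

/-- If `U.map f` is obtained by attaching cells `g`, then `f` is obtained by attaching the cells
`F.map (g a)` along the transposed attaching maps. -/
def attachCellsOfRightAdjoint (adj : F ⊣ U) (hadj : NatTrans.Coequifibered adj.unit)
    (c : AttachCells.{w} g (U.map f)) : AttachCells.{w} (fun a ↦ F.map (g a)) f :=
  have := adj.leftAdjoint_preservesColimits
  { ι := c.ι
    π := c.π
    cofan₁ := Cofan.mk (F.obj c.cofan₁.pt) fun i ↦ F.map (c.cofan₁.inj i)
    cofan₂ := Cofan.mk (F.obj c.cofan₂.pt) fun i ↦ F.map (c.cofan₂.inj i)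
    isColimit₁ := isColimitCofanMkObjOfIsColimit F _ _ c.isColimit₁
    isColimit₂ := isColimitCofanMkObjOfIsColimit F _ _ c.isColimit₂
    m := F.map c.m
    hm i := by simp only [Cofan.mk_pt, cofan_mk_inj, ← F.map_comp, c.hm]
    g₁ := (adj.homEquiv _ _).symm c.g₁
    g₂ := (adj.homEquiv _ _).symm c.g₂
    isPushout := by
      simpa only [isPushout_map_iff_isPushout_homEquiv adj hadj, Equiv.apply_symm_apply] using
        c.isPushout }

/-- If `f` is obtained by attaching cells `F.map (g a)`, then `U.map f` is obtained by attaching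
the cells `g` along the transposed attaching maps. -/
def attachCellsOfLeftAdjoint [HasCoproducts.{w} C] (adj : F ⊣ U)
    (hadj : NatTrans.Coequifibered adj.unit) (c : AttachCells.{w} (fun a ↦ F.map (g a)) f) :
    AttachCells.{w} g (U.map f) :=
  have := adj.leftAdjoint_preservesColimits
  { ι := c.ι
    π := c.π
    cofan₁ := _
    cofan₂ := _
    isColimit₁ := coproductIsCoproduct fun i ↦ X (c.π i)
    isColimit₂ := coproductIsCoproduct fun i ↦ Y (c.π i)
    m := Limits.Sigma.map fun i ↦ g (c.π i)
    hm i := Sigma.ι_map _ i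
    g₁ := adj.homEquiv _ _ ((mapSigmaIso _ F c.isColimit₁).hom ≫ c.g₁)
    g₂ := adj.homEquiv _ _ ((mapSigmaIso _ F c.isColimit₂).hom ≫ c.g₂)
    isPushout := (isPushout_map_iff_isPushout_homEquiv adj hadj).1 <|
      c.isPushout.of_iso (mapSigmaIso _ F c.isColimit₁).symm (Iso.refl _)
        (mapSigmaIso _ F c.isColimit₂).symm (Iso.refl _) (by simp)
        (by simp [Iso.eq_inv_comp, reassoc_of% mapSigmaIso_hom_comp _ F c.isColimit₁ c.isColimit₂ _
          c.m c.hm])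
        (by simp) (by simp) }

variable (adj : F ⊣ U) (hadj : NatTrans.Coequifibered adj.unit)

lemma attachingMap_attachCellsOfRightAdjoint (c : AttachCells.{w} g (U.map f)) (i : c.ι) :
    attachingMap (attachCellsOfRightAdjoint adj hadj c) i =
      (adj.homEquiv _ _).symm (attachingMap c i) :=
  (adj.homEquiv_naturality_left_symm _ _).symm

lemma cell_attachCellsOfRightAdjoint (c : AttachCells.{w} g (U.map f)) (i : c.ι) :
    (attachCellsOfRightAdjoint adj hadj c).cell i = (adj.homEquiv _ _).symm (c.cell i) :=
  (adj.homEquiv_naturality_left_symm _ _).symm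

variable [HasCoproducts.{w} C] (c : AttachCells.{w} (fun a ↦ F.map (g a)) f) (i : c.ι)

lemma attachingMap_attachCellsOfLeftAdjoint :
    attachingMap (attachCellsOfLeftAdjoint adj hadj c) i =
      adj.homEquiv _ _ (attachingMap c i) :=
  have := adj.leftAdjoint_preservesColimits
  ι_homEquiv_mapSigmaIso_hom_comp _ adj c.isColimit₁ c.g₁ i

lemma cell_attachCellsOfLeftAdjoint :
    (attachCellsOfLeftAdjoint adj hadj c).cell i = adj.homEquiv _ _ (c.cell i) :=
  have := adj.leftAdjoint_preservesColimits
  ι_homEquiv_mapSigmaIso_hom_comp _ adj c.isColimit₂ c.g₂ i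

end AttachCells

noncomputable section Bases

section Reindex

variable {D : Type*} [Category* D] {α β : Type*} {X Y : α → D} {g : ∀ a, X a ⟶ Y a}
  {X' Y' : β → D} (g' : ∀ b, X' b ⟶ Y' b) (p : α → β)
  (e : ∀ a, Arrow.mk (g a) ≅ Arrow.mk (g' (p a))) {B B' : D} {f : B ⟶ B'}
  (c : AttachCells.{w} g f) (i : c.ι)

lemma attachingMap_reindexCellTypes :
    attachingMap (c.reindexCellTypes g' p e) i = (e (c.π i)).inv.left ≫ attachingMap c i :=
  Category.assoc _ _ _

lemma cell_reindexCellTypes :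
    (c.reindexCellTypes g' p e).cell i = (e (c.π i)).inv.right ≫ c.cell i :=
  Category.assoc _ _ _

end Reindex

variable {C : Type*} [Category* C] {D : Type*} [Category* D] {F : C ⥤ D} {U : D ⥤ C}

lemma hom_comp_homEquiv_symm_comp (adj : F ⊣ U) {S : C} {S' B E : D} (e : S' ≅ F.obj S)
    {x : S ⟶ U.obj B} {φ : B ⟶ E} {y : S' ⟶ E}
    (h : x ≫ U.map φ = adj.homEquiv _ _ (e.inv ≫ y)) :
    (e.hom ≫ (adj.homEquiv _ _).symm x) ≫ φ = y := by
  rw [Category.assoc, ← adj.homEquiv_naturality_right_symm, h, Equiv.symm_apply_apply,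
    Iso.hom_inv_id_assoc]

variable [PreservesColimitsOfShape WalkingSpan U] [ReflectsColimitsOfShape WalkingSpan U]
  {α β : Type*} {X Y : α → C} {g : ∀ a, X a ⟶ Y a} {X' Y' : β → D} {g' : ∀ b, X' b ⟶ Y' b}
  (p : β → α) (e : ∀ b, Arrow.mk (g' b) ≅ Arrow.mk (F.map (g (p b))))
  (adj : F ⊣ U) (hadj : NatTrans.Coequifibered adj.unit) {B B' : D} {f : B ⟶ B'}

section OfFreeCells

variable [HasCoproducts.{w} C] (c : AttachCells.{w} g' f) (i : c.ι)

/-- If `f` is obtained by attaching cells which are free on the maps `g (p b)`, then `U.map f` is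
obtained by attaching the cells `g (p b)`. -/
def attachBases : AttachCells.{w} g (U.map f) :=
  attachCellsOfLeftAdjoint adj hadj (c.reindexCellTypes (fun a ↦ F.map (g a)) p e)

lemma attachingMap_attachBases :
    attachingMap (attachBases p e adj hadj c) i =
      adj.homEquiv _ _ ((e (c.π i)).inv.left ≫ attachingMap c i) :=
  (attachingMap_attachCellsOfLeftAdjoint adj hadj
    (c.reindexCellTypes (fun a ↦ F.map (g a)) p e) i).trans
    (congrArg _ (attachingMap_reindexCellTypes (fun a ↦ F.map (g a)) p e c i))

lemma cell_attachBases :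
    (attachBases p e adj hadj c).cell i =
      adj.homEquiv _ _ ((e (c.π i)).inv.right ≫ c.cell i) :=
  (cell_attachCellsOfLeftAdjoint adj hadj (c.reindexCellTypes (fun a ↦ F.map (g a)) p e) i).trans
    (congrArg _ (cell_reindexCellTypes (fun a ↦ F.map (g a)) p e c i))

end OfFreeCells

variable {p} (c : AttachCells.{w} (fun b ↦ g (p b)) (U.map f))

/-- If `U.map f` is obtained by attaching cells `g (p b)`, then `f` is obtained by attaching the
cells `g' b` which are free on them. -/
def attachFreeCells : AttachCells.{w} g' f :=
  (attachCellsOfRightAdjoint adj hadj c).reindexCellTypes g' id fun b ↦ (e b).symm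

variable {c} {i : c.ι} {E : D}

lemma attachingMap_attachFreeCells_comp {φ : B ⟶ E} {y : X' (c.π i) ⟶ E}
    (h : attachingMap c i ≫ U.map φ = adj.homEquiv _ _ ((e (c.π i)).inv.left ≫ y)) :
    attachingMap (attachFreeCells e adj hadj c) i ≫ φ = y := by
  have hc : attachingMap (attachFreeCells e adj hadj c) i =
      (e (c.π i)).hom.left ≫ (adj.homEquiv _ _).symm (attachingMap c i) :=
    (attachingMap_reindexCellTypes _ _ _ _ _).trans <|
      congrArg ((e (c.π i)).hom.left ≫ ·) (attachingMap_attachCellsOfRightAdjoint adj hadj c i)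
  exact (congrArg (· ≫ φ) hc).trans
    (hom_comp_homEquiv_symm_comp adj (Arrow.leftFunc.mapIso (e (c.π i))) h)

lemma cell_attachFreeCells_comp {φ : B' ⟶ E} {y : Y' (c.π i) ⟶ E}
    (h : c.cell i ≫ U.map φ = adj.homEquiv _ _ ((e (c.π i)).inv.right ≫ y)) :
    (attachFreeCells e adj hadj c).cell i ≫ φ = y := by
  have hc : (attachFreeCells e adj hadj c).cell i =
      (e (c.π i)).hom.right ≫ (adj.homEquiv _ _).symm (c.cell i) :=
    (cell_reindexCellTypes _ _ _ _ _).trans <|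
      congrArg ((e (c.π i)).hom.right ≫ ·) (cell_attachCellsOfRightAdjoint adj hadj c i)
  exact (congrArg (· ≫ φ) hc).trans
    (hom_comp_homEquiv_symm_comp adj (Arrow.rightFunc.mapIso (e (c.π i))) h)

end Bases

lemma preservesWellOrderContinuousOfShape_of_nonempty {C : Type*} [Category* C] {D : Type*}
    [Category* D] (U : D ⥤ C) (K : Type w) [LinearOrder K]
    (hU : ∀ (J : Type w) [LinearOrder J] [Nonempty J], PreservesColimitsOfShape J U) :
    PreservesWellOrderContinuousOfShape K U where
  preservesColimitsOfShape j hj := by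
    have : Nonempty (Set.Iio j) := hj.nonempty_Iio.to_subtype
    exact hU _

noncomputable section Basis

variable {C : Type*} [Category* C] {D : Type*} [Category* D] {F : C ⥤ D} {U : D ⥤ C}
  {I : MorphismProperty C}

lemma exists_arrow_mk_map_eq (a : (I.strictMap F).toSet) :
    ∃ i : I.toSet, Arrow.mk ((I.strictMap F).homFamily a) = Arrow.mk (F.map (I.homFamily i)) := by
  obtain ⟨⟨_, _, _⟩, ⟨hi⟩⟩ := a
  exact ⟨⟨Arrow.mk _, hi⟩, rfl⟩

/-- A choice of a map of `I` whose image under `F` is a given element of `I.strictMap F`. Since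
`F` need not be injective on arrows, the cells of an `I.strictMap F`-cell complex only become cells
of an `I`-cell complex after such a choice. -/
def basis (a : (I.strictMap F).toSet) : I.toSet :=
  (exists_arrow_mk_map_eq a).choose

/-- An element of `I.strictMap F` is the image of its basis. -/
def basisIso (a : (I.strictMap F).toSet) :
    Arrow.mk ((I.strictMap F).homFamily a) ≅ Arrow.mk (F.map (I.homFamily (basis a))) :=
  eqToIso (exists_arrow_mk_map_eq a).choose_spec

/-- The image under a right adjoint `U` of a relative cell complex whose cells are images under
the left adjoint `F` of maps in `I`, as a relative `I`-cell complex. -/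
def mapRelativeCellComplex [HasCoproducts.{w} C] [PreservesColimitsOfShape WalkingSpan U]
    [ReflectsColimitsOfShape WalkingSpan U] {K : Type*} [LinearOrder K] [OrderBot K] [SuccOrder K]
    [WellFoundedLT K] [PreservesColimitsOfShape K U] [PreservesWellOrderContinuousOfShape K U]
    (adj : F ⊣ U) (hadj : NatTrans.Coequifibered adj.unit) {X Y : D} {f : X ⟶ Y}
    (c : RelativeCellComplex.{w} (fun _ : K ↦ (I.strictMap F).homFamily) f) :
    RelativeCellComplex.{w} (fun _ : K ↦ I.homFamily) (U.map f) where
  toTransfiniteCompositionOfShape := c.toTransfiniteCompositionOfShape.map U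
  attachCells j hj := attachBases (f := c.F.map (homOfLE (Order.le_succ j))) basis basisIso adj hadj
    (c.attachCells j hj)

end Basis

section Small

universe u'

variable {C : Type u} [Category.{v} C] {D : Type u'} [Category.{v} D] {F : C ⥤ D} {U : D ⥤ C}

lemma relativeCells_strictMap_le (adj : F ⊣ U) (hadj : NatTrans.Coequifibered adj.unit)
    [PreservesColimitsOfShape WalkingSpan U] [ReflectsColimitsOfShape WalkingSpan U]
    (hU : ∀ (K : Type v) [LinearOrder K] [Nonempty K], PreservesColimitsOfShape K U)
    (I : MorphismProperty C) :
    relativeCells (I.strictMap F) ≤ (relativeCells I).inverseImage U := by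
  intro X Y f hf
  obtain ⟨K, _, _, _, _, ⟨h⟩⟩ := (MorphismProperty.transfiniteCompositions_iff _ _).1 hf
  refine (MorphismProperty.transfiniteCompositions_iff _ _).2 ⟨K, ‹_›, ‹_›, ‹_›, ‹_›, ⟨?_⟩⟩
  have := preservesWellOrderContinuousOfShape_of_nonempty U K hU
  have := hU K
  refine MorphismProperty.TransfiniteCompositionOfShape.map (F := U) (h.ofLE ?_)
  rintro B B' f ⟨_, _, _, _, _, ⟨hi⟩, sq⟩
  exact ⟨_, _, _, _, _, hi, (isPushout_map_iff_isPushout_homEquiv adj hadj).1 sq⟩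

lemma isSmallRelativeTo_leftAdjoint_obj (adj : F ⊣ U)
    (hU : ∀ (K : Type v) [LinearOrder K] [Nonempty K], PreservesColimitsOfShape K U)
    {P : MorphismProperty C} {Q : MorphismProperty D} (hPQ : Q ≤ P.inverseImage U)
    {W : C} (h : IsSmallRelativeTo W P) : IsSmallRelativeTo (F.obj W) Q := by
  obtain ⟨κ, h⟩ := h
  refine ⟨κ, fun μ hμ hκ G hG hQ ↦ ?_⟩
  have : Nonempty μ.ord.ToType := by
    rw [← Cardinal.mk_ne_zero_iff, Cardinal.mk_ord_toType]
    exact hμ.pos.ne'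
  have := preservesWellOrderContinuousOfShape_of_nonempty U μ.ord.ToType hU
  have := hU μ.ord.ToType
  have := h μ hμ hκ (G ⋙ U) inferInstance fun β ↦ hPQ _ (hQ β)
  have : PreservesColimit G (U ⋙ coyoneda.obj (op W)) := inferInstance
  exact preservesColimit_of_natIso G (adj.corepresentableBy W).toIso.symm

end Small

noncomputable section CellsUnder

variable {M : Type u} [Category.{v} M] {A : M}

instance preservesColimitsOfShape_forget_of_nonempty (K : Type*) [LinearOrder K] [Nonempty K] :
    PreservesColimitsOfShape K (Under.forget A) :=
  have := IsFiltered.isConnected K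
  inferInstance

lemma isWellOrderContinuous_of_comp_forget {K : Type*} [LinearOrder K] (G : K ⥤ Under A)
    (h : (G ⋙ Under.forget A).IsWellOrderContinuous) : G.IsWellOrderContinuous where
  nonempty_isColimit j hj := by
    have : Nonempty (Set.Iio j) := hj.nonempty_Iio.to_subtype
    have := IsFiltered.isConnected (Set.Iio j)
    exact ⟨isColimitOfReflects (Under.forget A) (h.nonempty_isColimit j hj).some⟩

section Lift

variable {K : Type*} [LinearOrder K] [OrderBot K] [SuccOrder K] [WellFoundedLT K]
  {X : Under A} {Z : M} {f : X.right ⟶ Z} (c : TransfiniteCompositionOfShape K f)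

/-- The sequence of a transfinite composition starting at `X.right`, as a sequence in `Under A`. -/
def sequenceUnder : K ⥤ Under A :=
  Under.lift c.F
    { app j := X.hom ≫ c.isoBot.inv ≫ c.F.map (homOfLE bot_le)
      naturality i j φ := by
        dsimp
        rw [Category.id_comp, Category.assoc, Category.assoc, ← c.F.map_comp]
        rfl }

lemma sequenceUnder_hom_comp_incl (j : K) :
    ((sequenceUnder c).obj j).hom ≫ c.incl.app j = X.hom ≫ f := by
  change (X.hom ≫ c.isoBot.inv ≫ c.F.map _) ≫ c.incl.app j = X.hom ≫ f
  have := c.incl.naturality (homOfLE (bot_le : ⊥ ≤ j))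
  dsimp at this
  rw [Category.assoc, Category.assoc, this, Category.comp_id, c.fac]

/-- A transfinite composition in `M` starting at `X.right` lifts to `Under A`. -/
def transfiniteCompositionUnder :
    TransfiniteCompositionOfShape K (Under.homMk f : X ⟶ Under.mk (X.hom ≫ f)) where
  F := sequenceUnder c
  isoBot := Under.isoMk c.isoBot (by
    change (X.hom ≫ c.isoBot.inv ≫ c.F.map (𝟙 _)) ≫ c.isoBot.hom = _
    simp)
  isWellOrderContinuous := isWellOrderContinuous_of_comp_forget _ c.isWellOrderContinuous
  incl :=
    { app j := Under.homMk (c.incl.app j) (sequenceUnder_hom_comp_incl c j)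
      naturality i j φ := by ext; exact c.incl.naturality φ }
  isColimit := Under.isColimitLiftCocone _ _ _ _ (sequenceUnder_hom_comp_incl c) c.isColimit
  fac := by ext; exact c.fac

end Lift

end CellsUnder

lemma Subcomplex.hom_ι {C : Type u} [Category.{v} C] {K : Type v} [LinearOrder K] [OrderBot K]
    [SuccOrder K] [WellFoundedLT K] {I : MorphismProperty C} {X Y : C} {f : X ⟶ Y}
    {c : RelativeCellComplex.{v} (fun _ : K ↦ I.homFamily) f} (s : Subcomplex c) :
    s.hom ≫ s.ι = f := by
  rw [← s.complex.fac, Category.assoc]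
  refine (congrArg (_ ≫ ·) (s.incl_ι ⊥)).trans ?_
  rw [← Category.assoc, s.φ_bot]
  exact c.fac

noncomputable section Compact

variable {M : Type u} [Category.{v} M] {A : M} [HasCoproducts.{v} M] {F : M ⥤ Under A}
  {I : MorphismProperty M}

/-- The relative `I`-cell complex underlying a relative cell complex on free maps under `A`. -/
def underlyingRelativeCellComplex (adj : F ⊣ Under.forget A)
    (hadj : NatTrans.Coequifibered adj.unit) {K : Type v} [LinearOrder K] [OrderBot K]
    [SuccOrder K] [WellFoundedLT K] {X Y : Under A} {f : X ⟶ Y}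
    (c : RelativeCellComplex.{v} (fun _ : K ↦ (I.strictMap F).homFamily) f) :
    RelativeCellComplex.{v} (fun _ : K ↦ I.homFamily) f.right :=
  have := preservesWellOrderContinuousOfShape_of_nonempty (Under.forget A) K
    fun _ ↦ inferInstance
  mapRelativeCellComplex adj hadj c

variable {adj : F ⊣ Under.forget A} {hadj : NatTrans.Coequifibered adj.unit}
  {K : Type v} [LinearOrder K] [OrderBot K] [SuccOrder K] [WellFoundedLT K] {X Y : Under A}
  {f : X ⟶ Y} {c : RelativeCellComplex.{v} (fun _ : K ↦ (I.strictMap F).homFamily) f}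
  (s : Subcomplex (underlyingRelativeCellComplex adj hadj c))

/-- The presentation under `A` of a subcomplex of the underlying relative cell complex: the same
sequence, with each cell replaced by the corresponding free cell. -/
def subcomplexUnderComplex : RelativeCellComplex.{v}
    (fun (j : K) (a : (hj : ¬ IsMax j) ×' (c.attachCells j hj).ι) ↦
      (I.strictMap F).homFamily ((c.attachCells j a.1).π a.2))
    (Under.homMk s.hom : X ⟶ Under.mk (X.hom ≫ s.hom)) where
  toTransfiniteCompositionOfShape :=
    transfiniteCompositionUnder s.complex.toTransfiniteCompositionOfShape
  attachCells j hj := attachFreeCells (fun a ↦ basisIso ((c.attachCells j a.1).π a.2)) adj hadj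
    (s.complex.attachCells j hj)

/-- The map of sequences under `A` given by a subcomplex of the underlying relative cell
complex. -/
def subcomplexUnderMap : (subcomplexUnderComplex s).F ⟶ c.F where
  app j := Under.homMk (s.φ.app j) (by
    have h₁ := s.φ.naturality (homOfLE (bot_le : ⊥ ≤ j))
    have h₂ : _ ≫ s.φ.app ⊥ = c.isoBot.inv.right := s.φ_bot
    change (X.hom ≫ s.complex.isoBot.inv ≫ s.complex.F.map _) ≫ s.φ.app j = _
    rw [Category.assoc, Category.assoc, h₁, ← Category.assoc _ (s.φ.app ⊥), h₂]
    exact ((Category.assoc _ _ _).symm.trans (congrArg (· ≫ _) (Under.w c.isoBot.inv))).trans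
      (Under.w (c.F.map (homOfLE (bot_le : ⊥ ≤ j)))))
  naturality i j φ := by ext; exact s.φ.naturality φ

variable (j : K) (hj : ¬ IsMax j) (i : (s.complex.attachCells j hj).ι)

lemma attachingMap_subcomplexUnderComplex_comp :
    attachingMap ((subcomplexUnderComplex s).attachCells j hj) i ≫ (subcomplexUnderMap s).app j =
      attachingMap (c.attachCells j hj) ((s.complex.attachCells j hj).π i).2 :=
  attachingMap_attachFreeCells_comp
    (f := (subcomplexUnderComplex s).F.map (homOfLE (Order.le_succ j))) _ adj hadj
    (φ := (subcomplexUnderMap s).app j)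
    ((s.attaching_map j hj i).trans
      (attachingMap_attachBases basis basisIso adj hadj (c.attachCells j hj) _))

lemma cell_subcomplexUnderComplex_comp :
    ((subcomplexUnderComplex s).attachCells j hj).cell i ≫
        (subcomplexUnderMap s).app (Order.succ j) =
      (c.attachCells j hj).cell ((s.complex.attachCells j hj).π i).2 :=
  cell_attachFreeCells_comp
    (f := (subcomplexUnderComplex s).F.map (homOfLE (Order.le_succ j))) _ adj hadj
    (φ := (subcomplexUnderMap s).app (Order.succ j))
    ((s.characteristic_map j hj i).trans
      (cell_attachBases basis basisIso adj hadj (c.attachCells j hj) _))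

/-- The lift to `Under A` of a subcomplex of the underlying relative cell complex. -/
def subcomplexUnder : Subcomplex c where
  Z := Under.mk (X.hom ≫ s.hom)
  hom := Under.homMk s.hom
  complex := subcomplexUnderComplex s
  π_injective := s.π_injective
  φ := subcomplexUnderMap s
  φ_bot := by ext; exact s.φ_bot
  attaching_map := attachingMap_subcomplexUnderComplex_comp s
  characteristic_map := cell_subcomplexUnderComplex_comp s
  ι := Under.homMk s.ι (by
    change (X.hom ≫ s.hom) ≫ s.ι = Y.hom
    rw [Category.assoc, s.hom_ι, Under.w])
  incl_ι j := by
    ext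
    exact (s.incl_ι j).trans (congrArg (s.φ.app j ≫ ·) (Category.comp_id _))

lemma subcomplexUnder_size_le : (subcomplexUnder s).size ≤ s.size := by
  refine Cardinal.mk_le_of_injective (f := fun x ↦ (⟨x.j, x.hj, x.k⟩ : s.complex.Cells)) ?_
  rintro ⟨j, hj, k⟩ ⟨j', hj', k'⟩ hx
  cases hx
  rfl

lemma isCompactRelativeTo_leftAdjoint_obj (adj : F ⊣ Under.forget A)
    (hadj : NatTrans.Coequifibered adj.unit) {W : M} (h : IsCompactRelativeTo W I) :
    IsCompactRelativeTo (F.obj W) (I.strictMap F) := by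
  obtain ⟨γ, h⟩ := h
  refine ⟨γ, fun K _ _ _ _ X Y f c g ↦ ?_⟩
  obtain ⟨s, hs, l, hl⟩ :=
    h K _ _ _ (underlyingRelativeCellComplex adj hadj c) (adj.homEquiv _ _ g)
  refine ⟨subcomplexUnder s, (subcomplexUnder_size_le s).trans hs,
    (adj.homEquiv W (subcomplexUnder s).Z).symm l, ?_⟩
  exact (adj.homEquiv_naturality_right_symm l (subcomplexUnder s).ι).symm.trans
    ((Equiv.symm_apply_eq _).2 hl)

end Compact

section Factorization

variable {M : Type u} [Category.{v} M] {A : M}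

lemma hasLiftingProperty_under {X Y Z W : Under A} (i : X ⟶ Y) (p : Z ⟶ W)
    [HasLiftingProperty i.right p.right] : HasLiftingProperty i p where
  sq_hasLift {f g} sq := by
    have sq' : CommSq f.right i.right p.right g.right := sq.map (Under.forget A)
    exact ⟨⟨{
      l := Under.homMk sq'.lift (by rw [← Under.w i, Category.assoc, sq'.fac_left, Under.w f])
      fac_left := by ext; exact sq'.fac_left
      fac_right := by ext; exact sq'.fac_right }⟩⟩

lemma isEffectiveMono_under {X Y : Under A} {f : X ⟶ Y} (h : IsEffectiveMono f.right) :
    IsEffectiveMono f := by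
  obtain ⟨P, i₁, i₂, sq, ⟨hf⟩⟩ := h
  have w₂ : Y.hom ≫ i₂ = Y.hom ≫ i₁ := by
    rw [← Under.w f, Category.assoc, Category.assoc, sq.w]
  let j₁ : Y ⟶ Under.mk (Y.hom ≫ i₁) := Under.homMk i₁
  let j₂ : Y ⟶ Under.mk (Y.hom ≫ i₁) := Under.homMk i₂ w₂
  have hj : f ≫ j₁ = f ≫ j₂ := by ext; exact sq.w
  exact ⟨_, j₁, j₂, .of_map (Under.forget A) hj sq,
    ⟨isLimitOfIsLimitForkMap (Under.forget A) hj hf⟩⟩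

variable {W₁ W₂ : MorphismProperty M}

/-- A factorization of `f.right` lifts to a factorization of `f` in the undercategory. -/
def mapFactorizationDataUnder {X Y : Under A} {f : X ⟶ Y}
    (h : MorphismProperty.MapFactorizationData W₁ W₂ f.right) :
    MorphismProperty.MapFactorizationData W₁.under W₂.under f where
  Z := Under.mk (X.hom ≫ h.i)
  i := Under.homMk h.i
  p := Under.homMk h.p (by simp)
  fac := by ext; exact h.fac
  hi := h.hi
  hp := h.hp

instance hasFactorization_under [W₁.HasFactorization W₂] :
    (W₁.under (X := A)).HasFactorization W₂.under where
  nonempty_mapFactorizationData f :=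
    ⟨mapFactorizationDataUnder (MorphismProperty.factorizationData W₁ W₂ f.right)⟩

/-- A functorial factorization lifts to a functorial factorization in the undercategory. -/
def functorialFactorizationDataUnder (h : W₁.FunctorialFactorizationData W₂) :
    (W₁.under (X := A)).FunctorialFactorizationData W₂.under where
  Z :=
    { obj f := Under.mk (f.left.hom ≫ (h.factorizationData f.hom.right).i)
      map {f g} φ := Under.homMk (h.mapZ ((Under.forget A).mapArrow.map φ)) (by
        refine (Category.assoc _ _ _).trans ((congrArg (f.left.hom ≫ ·)
          (h.i_mapZ ((Under.forget A).mapArrow.map φ))).trans ?_)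
        exact (Category.assoc _ _ _).symm.trans (congrArg (· ≫ _) (Under.w φ.left)))
      map_id f := by ext; exact h.mapZ_id f.hom.right
      map_comp φ ψ := by
        ext
        exact h.mapZ_comp ((Under.forget A).mapArrow.map φ) ((Under.forget A).mapArrow.map ψ) }
  i :=
    { app f := Under.homMk (U := f.left) (h.factorizationData f.hom.right).i
      naturality f g φ := by ext; exact (h.i_mapZ ((Under.forget A).mapArrow.map φ)).symm }
  p :=
    { app f := Under.homMk (V := f.right) (h.factorizationData f.hom.right).p (by
        dsimp
        rw [Category.assoc, MorphismProperty.MapFactorizationData.fac, Under.w])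
      naturality f g φ := by ext; exact h.mapZ_p ((Under.forget A).mapArrow.map φ) }
  fac := by ext f; exact (h.factorizationData f.hom.right).fac
  hi f := (h.factorizationData f.hom.right).hi
  hp f := (h.factorizationData f.hom.right).hp

lemma hasFunctorialFactorization_under (h : W₁.HasFunctorialFactorization W₂) :
    (W₁.under (X := A)).HasFunctorialFactorization W₂.under where
  nonempty_functorialFactorizationData :=
    ⟨functorialFactorizationDataUnder h.nonempty_functorialFactorizationData.some⟩

end Factorization

section Costar

variable {M : Type u} [Category.{v} M] [HasBinaryCoproducts M] {A : M}
  {I : MorphismProperty M} {W : M}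

lemma isSmallRelativeTo_costar_obj (h : IsSmallRelativeTo W (relativeCells I)) :
    IsSmallRelativeTo ((Under.costar A).obj W)
      (relativeCells (I.strictMap (Under.costar A))) :=
  isSmallRelativeTo_leftAdjoint_obj (Under.costarAdjForget A) (fun _ ↦ inferInstance)
    (relativeCells_strictMap_le (Under.costarAdjForget A) (coequifibered_unit_costarAdjForget A)
      (fun _ ↦ inferInstance) I) h

lemma isCompactRelativeTo_costar_obj [HasCoproducts.{v} M]
    (h : IsCompactRelativeTo W I) :
    IsCompactRelativeTo ((Under.costar A).obj W) (I.strictMap (Under.costar A)) :=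
  isCompactRelativeTo_leftAdjoint_obj (Under.costarAdjForget A)
    (coequifibered_unit_costarAdjForget A) h

end Costar

section ModelStructure

variable {M : Type u} [Category.{v} M] (A : M)

/-- The cofibrations under `A` are created by the forgetful functor. -/
scoped instance categoryWithCofibrationsUnder [CategoryWithCofibrations M] :
    CategoryWithCofibrations (Under A) where
  cofibrations := (cofibrations M).under

/-- The fibrations under `A` are created by the forgetful functor. -/
scoped instance categoryWithFibrationsUnder [CategoryWithFibrations M] :
    CategoryWithFibrations (Under A) where
  fibrations := (fibrations M).under

/-- The weak equivalences under `A` are created by the forgetful functor. -/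
scoped instance categoryWithWeakEquivalencesUnder [CategoryWithWeakEquivalences M] :
    CategoryWithWeakEquivalences (Under A) where
  weakEquivalences := (weakEquivalences M).under

lemma cofibrations_under [CategoryWithCofibrations M] :
    cofibrations (Under A) = (cofibrations M).under := rfl

lemma fibrations_under [CategoryWithFibrations M] :
    fibrations (Under A) = (fibrations M).under := rfl

lemma weakEquivalences_under [CategoryWithWeakEquivalences M] :
    weakEquivalences (Under A) = (weakEquivalences M).under := rfl

lemma trivialCofibrations_under [CategoryWithCofibrations M] [CategoryWithWeakEquivalences M] :
    trivialCofibrations (Under A) = (trivialCofibrations M).under := rfl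

lemma trivialFibrations_under [CategoryWithFibrations M] [CategoryWithWeakEquivalences M] :
    trivialFibrations (Under A) = (trivialFibrations M).under := rfl

variable [ModelCategory M]

/-- The model structure on `Under A` in which the three classes of morphisms are created by the
forgetful functor to `M`. -/
scoped instance modelCategoryUnder : ModelCategory (Under A) where
  cm1a := ⟨fun _ _ _ ↦ inferInstance⟩
  cm2 := by rw [weakEquivalences_under, MorphismProperty.under_eq_inverseImage]; infer_instance
  cm3a := by rw [weakEquivalences_under, MorphismProperty.under_eq_inverseImage]; infer_instance
  cm3b := by rw [fibrations_under, MorphismProperty.under_eq_inverseImage]; infer_instance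
  cm3c := by rw [cofibrations_under, MorphismProperty.under_eq_inverseImage]; infer_instance
  cm4a i p hi hw hp := by
    have : Cofibration i.right := ⟨hi.mem⟩
    have : WeakEquivalence i.right := ⟨hw.mem⟩
    have : Fibration p.right := ⟨hp.mem⟩
    exact hasLiftingProperty_under i p
  cm4b i p hi hp hw := by
    have : Cofibration i.right := ⟨hi.mem⟩
    have : Fibration p.right := ⟨hp.mem⟩
    have : WeakEquivalence p.right := ⟨hw.mem⟩
    exact hasLiftingProperty_under i p
  cm5a := by rw [trivialCofibrations_under, fibrations_under]; infer_instance
  cm5b := by rw [trivialFibrations_under, cofibrations_under]; infer_instance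

variable {A}

lemma hasFunctorialFactorizations_under (h : HasFunctorialFactorizations M) :
    HasFunctorialFactorizations (Under A) :=
  ⟨hasFunctorialFactorization_under h.1, hasFunctorialFactorization_under h.2⟩

lemma isProper_under (h : IsProper M) : IsProper (Under A) :=
  ⟨fun _ _ _ _ _ _ _ _ sq hw hi ↦ h.1 (sq.map (Under.forget A)) hw hi,
    fun _ _ _ _ _ _ _ _ sq hw hp ↦ h.2 (sq.map (Under.forget A)) hw hp⟩

variable {I J : MorphismProperty M}

lemma isCofibrantlyGeneratedBy_under (h : IsCofibrantlyGeneratedBy I J) :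
    IsCofibrantlyGeneratedBy (I.strictMap (Under.costar A)) (J.strictMap (Under.costar A)) where
  isSmall_I := by
    have := h.isSmall_I
    infer_instance
  isSmall_J := by
    have := h.isSmall_J
    infer_instance
  small_dom_I := by
    rintro _ _ _ ⟨hi⟩
    exact isSmallRelativeTo_costar_obj (h.small_dom_I _ hi)
  small_dom_J := by
    rintro _ _ _ ⟨hj⟩
    exact isSmallRelativeTo_costar_obj (h.small_dom_J _ hj)
  fibrations_eq := by
    rw [fibrations_under, rlp_strictMap (Under.costarAdjForget A), h.fibrations_eq,
      MorphismProperty.under_eq_inverseImage]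
  trivialFibrations_eq := by
    rw [trivialFibrations_under, rlp_strictMap (Under.costarAdjForget A),
      h.trivialFibrations_eq, MorphismProperty.under_eq_inverseImage]

lemma isCellularBy_under [HasCoproducts.{v} M] (h : IsCellularBy I J) :
    IsCellularBy (I.strictMap (Under.costar A)) (J.strictMap (Under.costar A)) where
  toIsCofibrantlyGeneratedBy := isCofibrantlyGeneratedBy_under h.toIsCofibrantlyGeneratedBy
  compact_I := by
    rintro _ _ _ ⟨hi⟩
    exact (h.compact_I _ hi).imp isCompactRelativeTo_costar_obj isCompactRelativeTo_costar_obj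
  compact_J := by
    rintro _ _ _ ⟨hj⟩
    exact (h.compact_J _ hj).imp isCompactRelativeTo_costar_obj isCompactRelativeTo_costar_obj
  small_dom_J_I := by
    rintro _ _ _ ⟨hj⟩
    exact isSmallRelativeTo_costar_obj (h.small_dom_J_I _ hj)
  effectiveMono _ _ f hf := isEffectiveMono_under (h.effectiveMono f.right hf)

end ModelStructure

end UnderModel

theorem mainTheorem8_general (M : Type u) [Category.{v} M] [ModelCategory M] (A : M) :
    (HasLimits M → HasLimits (Under A)) ∧ (HasColimits M → HasColimits (Under A)) ∧
    ∃ _ : ModelCategory (Under A),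
      (∀ ⦃B C : Under A⦄ (f : B ⟶ C),
        (weakEquivalences (Under A) f ↔ weakEquivalences M f.right) ∧
        (cofibrations (Under A) f ↔ cofibrations M f.right) ∧
        (fibrations (Under A) f ↔ fibrations M f.right)) ∧
      (UnderModel.HasFunctorialFactorizations M →
        UnderModel.HasFunctorialFactorizations (Under A)) ∧
      (UnderModel.IsProper M → UnderModel.IsProper (Under A)) ∧
      (UnderModel.IsCofibrantlyGenerated M → UnderModel.IsCofibrantlyGenerated (Under A)) ∧
      (HasCoproducts.{v} M → UnderModel.IsCellular M → UnderModel.IsCellular (Under A)) :=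
  ⟨fun _ ↦ inferInstance, fun _ ↦ inferInstance, UnderModel.modelCategoryUnder A,
    fun _ _ _ ↦ ⟨Iff.rfl, Iff.rfl, Iff.rfl⟩, UnderModel.hasFunctorialFactorizations_under,
    UnderModel.isProper_under,
    fun ⟨_, _, h⟩ ↦ ⟨_, _, UnderModel.isCofibrantlyGeneratedBy_under h⟩,
    fun _ ⟨_, _, h⟩ ↦ ⟨_, _, UnderModel.isCellularBy_under h⟩⟩

theorem mainTheorem8 (M : Type u) [Category.{v} M] [ModelCategory M]
    [HasLimits M] [HasColimits M] (A : M) :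
    HasLimits (Under A) ∧ HasColimits (Under A) ∧
    ∃ _ : ModelCategory (Under A),
      (∀ ⦃B C : Under A⦄ (f : B ⟶ C),
        (weakEquivalences (Under A) f ↔ weakEquivalences M f.right) ∧
        (cofibrations (Under A) f ↔ cofibrations M f.right) ∧
        (fibrations (Under A) f ↔ fibrations M f.right)) ∧
      (UnderModel.HasFunctorialFactorizations M →
        UnderModel.HasFunctorialFactorizations (Under A)) ∧
      (UnderModel.IsProper M → UnderModel.IsProper (Under A)) ∧
      (UnderModel.IsCofibrantlyGenerated M → UnderModel.IsCofibrantlyGenerated (Under A)) ∧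
      (UnderModel.IsCellular M → UnderModel.IsCellular (Under A)) := by
  obtain ⟨hlim, hcolim, hM, hf, hfact, hproper, hgen, hcell⟩ := mainTheorem8_general M A
  exact ⟨hlim ‹_›, hcolim ‹_›, hM, hf, hfact, hproper, hgen, hcell inferInstance⟩
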